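/- Let $\mathcal P(\mathbb N_0)$ be the set of probability measures on $\mathbb N_0=\{0,1,2,\dots\}$, and for $F\in\mathcal P(\mathbb N_0)$ put $\overline F=\sum_k kF[k]$ and $\tilde F=\overline F^{\,-2}\sum_k k(k-1)F[k]$. Let $\xi=(F_k)_{k\in\mathbb Z}$ be an i.i.d. sequence of random elements of $\mathcal P(\mathbb N_0)$ (the environment) with law $P_E$, and put $X_k=\log\overline F_k$ and $\eta_k=\tilde F_k$. Let $\mu$ be a probability measure on $\mathbb Z$. Given $\xi$, let $P_\xi$ be the law of the branching random walk that starts from one particle at $0$, in which each particle of generation $n-1$ has, independently of all others, a number of children with law $F_n$ ($n\ge 1$), and the displacements of the children from their parents are i.i.d. with law $\mu$ and independent of the genealogical tree. Let $M$ be the supremum of the positions of all particles that ever live. Assume that (i) $a:=\mathbb E[X_1]\in(-\infty,0)$ and $\mathbb E[e^{\rho X_1}]<\infty$ for all $\rho\ge 0$; (ii) $\mu$ is not a point mass, $\mu(\{2,3,\dots\})=0$, and $\mu$ has mean $0$; (iii) $\mathbb E[\eta_1]<\infty$. Let $\Lambda_s(\lambda)=\log\sum_{h\in\mathbb Z}e^{\lambda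 h}\mu(\{h\})$ for $\lambda>0$. Then the equation $\Lambda_s(\lambda)=-a$ has a unique solution $\lambda_0$ in $(0,\infty)$, and for $P_E$-almost every environment $\xi$, $$\lim_{x\to\infty}\frac1x\log P_\xi(M\ge x)=-\lambda_0 .$$ -/

import Mathlib

open MeasureTheory ProbabilityTheory Filter Topology
open scoped ENNReal

noncomputable section

namespace BRWRE

/-! ### Offspring laws and environments -/

/-- The mean `∑ k F[k]` of an offspring law on `{0, 1, 2, …}`, with values in `[0, ∞]`. -/
def offspringMean (F : ProbabilityMeasure ℕ) : ℝ≥0∞ :=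
  ∑' k : ℕ, (k : ℝ≥0∞) * (F : Measure ℕ) {k}

/-- The logarithm of the mean of an offspring law. It has its usual meaning when the mean is
neither zero nor infinite. -/
def logMean (F : ProbabilityMeasure ℕ) : ℝ :=
  Real.log (offspringMean F).toReal

/-- The normalized second factorial moment `(∑ k (k - 1) F[k]) / (∑ k F[k]) ^ 2`, with values
in `[0, ∞]`. -/
def normalizedFactorialMoment (F : ProbabilityMeasure ℕ) : ℝ≥0∞ :=
  (∑' k : ℕ, ((k * (k - 1) : ℕ) : ℝ≥0∞) * (F : Measure ℕ) {k}) / offspringMean F ^ 2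

/-- A two-sided environment: a sequence of offspring laws indexed by `ℤ`. -/
abbrev Environment : Type := ℤ → ProbabilityMeasure ℕ

/-- The law of an environment made of i.i.d. offspring laws with common distribution `Q`. -/
def environmentLaw (Q : Measure (ProbabilityMeasure ℕ)) : Measure Environment :=
  Measure.infinitePi fun _ : ℤ => Q

/-- The subcriticality assumption on the distribution `Q` of a random offspring law with log-mean
`X`: the expectation of `X` is finite and negative (so that, in particular, the mean offspring
number is almost surely neither zero nor infinite), and `E[exp (ρ X)] < ∞` for all `ρ ≥ 0`. -/
structure SubcriticalEnvironment (Q : Measure (ProbabilityMeasure ℕ)) : Prop where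
  mean_ne_zero : ∀ᵐ F ∂Q, offspringMean F ≠ 0
  mean_ne_top : ∀ᵐ F ∂Q, offspringMean F ≠ ∞
  integrable_logMean : Integrable logMean Q
  integral_logMean_neg : ∫ F, logMean F ∂Q < 0
  integrable_exp : ∀ ρ : ℝ, 0 ≤ ρ → Integrable (fun F => Real.exp (ρ * logMean F)) Q

/-! ### Jump laws -/

/-- The assumption on the jump law `μ` on `ℤ`: it is non-trivial, it gives no mass to
`{2, 3, …}`, and it has mean zero. -/
structure JumpAssumption (μ : Measure ℤ) : Prop where
  nontrivial : ∀ c : ℤ, μ ≠ Measure.dirac c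
  no_overshoot : μ (Set.Ici 2) = 0
  integrable : Integrable (fun h : ℤ => (h : ℝ)) μ
  mean_zero : ∫ h : ℤ, (h : ℝ) ∂μ = 0

/-- The log-Laplace transform `log E[exp (l h)]` of the jump law. -/
def jumpLogLaplace (μ : Measure ℤ) (l : ℝ) : ℝ :=
  cgf (fun h : ℤ => (h : ℝ)) μ l

/-! ### The branching random walk in a given environment -/

/-- The marks of the Ulam–Harris tree. Vertices are finite words in `ℕ`, read from the root (the
empty word); children are numbered from `0`. The mark of a vertex is its number of children
together with the displacements of its (potential) children relative to it. -/
abbrev Marks : Type := List ℕ → ℕ × (ℕ → ℤ)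

/-- The quenched law: the marks are independent; a vertex `ν` of generation `|ν|` has a number of
children with law `ξ (|ν| + 1)`, and the displacements of its children are i.i.d. with law `μ`. -/
def quenchedLaw (μ : Measure ℤ) (ξ : Environment) : Measure Marks :=
  Measure.infinitePi fun ν : List ℕ =>
    ((ξ ((ν.length : ℤ) + 1) : ProbabilityMeasure ℕ) : Measure ℕ).prod
      (Measure.infinitePi fun _ : ℕ => μ)

/-- The genealogical tree: a word belongs to it when each of its letters is smaller than the number
of children of the prefix preceding that letter. -/
def tree (ω : Marks) : Set (List ℕ) :=
  {ν | ∀ k : Fin ν.length, ν.get k < (ω (ν.take k)).1}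

/-- The position of a vertex: the sum of the displacements along its ancestral line. -/
def position (ω : Marks) (ν : List ℕ) : ℤ :=
  ∑ k : Fin ν.length, (ω (ν.take k)).2 (ν.get k)

/-- The maximal position in generation `n` (`-∞` if the generation is empty). -/
def generationMax (ω : Marks) (n : ℕ) : EReal :=
  ⨆ ν ∈ {ν ∈ tree ω | ν.length = n}, (((position ω ν : ℤ) : ℝ) : EReal)

/-- The maximal displacement of the whole system. -/
def maxDisplacement (ω : Marks) : EReal :=
  ⨆ n : ℕ, generationMax ω n

/-- The quenched tail probability that the maximal displacement is at least `x`. -/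
def quenchedTail (μ : Measure ℤ) (ξ : Environment) (x : ℝ) : ℝ :=
  (quenchedLaw μ ξ).real {ω | (x : EReal) ≤ maxDisplacement ω}

end BRWRE

end

/-!
The probability `r(ξ, n, x)` that some particle of the generations `0, …, n` is at or above the level
`x` obeys, for `x > 0`, a one-step recursion (`reachProb_succ`): if `s` is the average of
`r(θξ, n, x - h)` over the jump law `μ(h)`, where `θ` shifts the environment by one generation, then
`r(ξ, n + 1, x) = E[1 - (1 - s) ^ K]`, where `K` has the offspring law of the root. Both halves of
the theorem are inductions along this recursion, so that no moment of the branching random walk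
itself has to be computed. Write `m` for the mean of `K`, `η` for its normalized second factorial
moment, `φ` for the Laplace transform of `μ`, and `S_n` for the sum of the logarithmic means of the
first `n` generations.

For the upper bound, `E[1 - (1 - s) ^ K] ≤ m s`, which gives
`r(ξ, n, x) ≤ e ^ (-l x) ∑ e ^ (S_j) φ(l) ^ j` (`reachProb_le`). By the law of large numbers the
series converges whenever `log φ(l) < -a`, and by convexity of `φ` this holds for all `l` in
`(0, λ₀)`.

For the lower bound, the second moment inequality for one generation reads `m s ≤ r (1 + m s η)`,
that is, `1 / r ≤ 1 / (m s) + η`. Tilting the jump law by `e ^ (λ₀ h)` gives the walk a drift `v` in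
`(0, 1]`, so the linear function `v n - x` of the remaining time `n` and the remaining distance `x`
is harmonic for the tilted walk. As the walk cannot jump over a level, this harmonic function,
normalized and weighted with `e ^ (-λ₀ x)` and the means of the environment, can be kept below `1` up
to the time at which the level is reached, and it bounds `r` from below up to the factor
`1 + ∑ η_k` (`le_reachProb`). With a horizon of about `2 x / v` generations, the laws of large
numbers for `S_n` and for `∑ η_k` show that all factors other than `e ^ (-λ₀ x)` are subexponential
in `x`.
-/

noncomputable section

namespace BRWRE

/-! ### The branching property -/

/-- The environment seen from generation one. -/
def shift (ξ : Environment) : Environment := fun k => ξ (k + 1)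

/-- The marks of the descendants of the `i`-th child of the root, relabelled so that this child
becomes the root. -/
def subtree (ω : Marks) (i : ℕ) : Marks := fun ν => ω (i :: ν)

/-- The event that some particle of one of the generations `0, …, n` has a position `≥ x`. -/
def reach (n : ℕ) (x : ℤ) : Set Marks :=
  {ω | ∃ ν ∈ tree ω, ν.length ≤ n ∧ x ≤ position ω ν}

lemma nil_mem_tree (ω : Marks) : [] ∈ tree ω := fun k => k.elim0

lemma position_nil (ω : Marks) : position ω [] = 0 := by simp [position]

lemma cons_mem_tree (ω : Marks) (i : ℕ) (ν : List ℕ) :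
    i :: ν ∈ tree ω ↔ i < (ω []).1 ∧ ν ∈ tree (subtree ω i) := by
  simp only [tree, Set.mem_ofPred_eq, List.length_cons, Fin.forall_fin_succ]
  simp [subtree]

lemma position_cons (ω : Marks) (i : ℕ) (ν : List ℕ) :
    position ω (i :: ν) = (ω []).2 i + position (subtree ω i) ν := by
  simp only [position, List.length_cons, Fin.sum_univ_succ]
  simp [subtree]

lemma mem_reach_of_nonpos (ω : Marks) (n : ℕ) {x : ℤ} (hx : x ≤ 0) : ω ∈ reach n x :=
  ⟨[], nil_mem_tree ω, by simp, by simpa [position_nil] using hx⟩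

lemma not_mem_reach_zero (ω : Marks) {x : ℤ} (hx : 0 < x) : ω ∉ reach 0 x := by
  rintro ⟨ν, -, hl, hp⟩
  obtain rfl : ν = [] := List.eq_nil_of_length_eq_zero (by omega)
  rw [position_nil] at hp
  omega

lemma mem_reach_succ (ω : Marks) (n : ℕ) {x : ℤ} (hx : 0 < x) :
    ω ∈ reach (n + 1) x ↔ ∃ i < (ω []).1, subtree ω i ∈ reach n (x - (ω []).2 i) := by
  constructor
  · rintro ⟨ν, ht, hl, hp⟩
    cases ν with
    | nil => rw [position_nil] at hp; omega
    | cons i ν =>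
      rw [cons_mem_tree] at ht
      rw [position_cons] at hp
      exact ⟨i, ht.1, ν, ht.2, by simpa using hl, by omega⟩
  · rintro ⟨i, hi, ν, ht, hl, hp⟩
    exact ⟨i :: ν, (cons_mem_tree ω i ν).2 ⟨hi, ht⟩, by simpa using hl, by
      rw [position_cons]; omega⟩

lemma reach_mono (x : ℤ) : Monotone fun n => reach n x := fun _ _ h _ ⟨ν, ht, hl, hp⟩ =>
  ⟨ν, ht, hl.trans h, hp⟩

lemma measurable_subtree (i : ℕ) : Measurable fun ω : Marks => subtree ω i :=
  measurable_pi_lambda _ fun ν => measurable_pi_apply (i :: ν)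

lemma measurableSet_reach (n : ℕ) (x : ℤ) : MeasurableSet (reach n x) := by
  induction n generalizing x with
  | zero =>
    rcases le_or_gt x 0 with hx | hx
    · rw [show reach 0 x = Set.univ from Set.eq_univ_of_forall fun ω => mem_reach_of_nonpos ω 0 hx]
      exact .univ
    · rw [show reach 0 x = ∅ from Set.eq_empty_of_forall_notMem fun ω => not_mem_reach_zero ω hx]
      exact .empty
  | succ n ih =>
    rcases le_or_gt x 0 with hx | hx
    · rw [show reach (n + 1) x = Set.univ from
        Set.eq_univ_of_forall fun ω => mem_reach_of_nonpos ω _ hx]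
      exact .univ
    · have : reach (n + 1) x = ⋃ i : ℕ, ⋃ d : ℤ, {ω : Marks | i < (ω []).1} ∩
          ({ω : Marks | (ω []).2 i = d} ∩ (fun ω => subtree ω i) ⁻¹' reach n (x - d)) := by
        ext ω
        simp [mem_reach_succ ω n hx]
      rw [this]
      refine .iUnion fun i => .iUnion fun d => .inter ?_ (.inter ?_ ?_)
      · exact measurableSet_lt measurable_const (measurable_fst.comp (measurable_pi_apply _))
      · exact measurableSet_eq_fun ((measurable_pi_apply i).comp
          (measurable_snd.comp (measurable_pi_apply ([] : List ℕ)))) measurable_const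
      · exact measurable_subtree i (ih _)

/-- The quenched probability that a particle of the first `n` generations gets to `x`. -/
def reachProb (μ : Measure ℤ) (ξ : Environment) (n : ℕ) (x : ℤ) : ℝ :=
  (quenchedLaw μ ξ).real (reach n x)

lemma reachProb_nonneg (μ : Measure ℤ) (ξ : Environment) (n : ℕ) (x : ℤ) : 0 ≤ reachProb μ ξ n x :=
  measureReal_nonneg

lemma reachProb_zero (μ : Measure ℤ) (ξ : Environment) {x : ℤ} (hx : 0 < x) :
    reachProb μ ξ 0 x = 0 := by
  rw [reachProb, show reach 0 x = ∅ from
    Set.eq_empty_of_forall_notMem fun ω => not_mem_reach_zero ω hx, measureReal_empty]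

/-- The probability that a given particle of generation one has a descendant (possibly itself) in the
generations up to `n + 1` that gets to `x`. -/
def childReachProb (μ : Measure ℤ) (ξ : Environment) (n : ℕ) (x : ℤ) : ℝ :=
  ∫ h, reachProb μ (shift ξ) n (x - h) ∂μ

lemma childReachProb_nonneg (μ : Measure ℤ) (ξ : Environment) (n : ℕ) (x : ℤ) :
    0 ≤ childReachProb μ ξ n x :=
  integral_nonneg fun _ => reachProb_nonneg ..

instance isProbabilityMeasure_quenchedLaw (μ : Measure ℤ) [IsProbabilityMeasure μ]
    (ξ : Environment) : IsProbabilityMeasure (quenchedLaw μ ξ) := by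
  unfold quenchedLaw; infer_instance

section

variable (μ : Measure ℤ) [IsProbabilityMeasure μ]

lemma map_subtree_quenchedLaw (ξ : Environment) :
    (quenchedLaw μ ξ).map (fun ω i => subtree ω i) =
      Measure.infinitePi fun _ : ℕ => quenchedLaw μ (shift ξ) := by
  have h1 := Measure.map_infinitePi_infinitePi_of_inj
    (P := fun ν : List ℕ => ((ξ ((ν.length : ℤ) + 1) : ProbabilityMeasure ℕ) : Measure ℕ).prod
      (Measure.infinitePi fun _ : ℕ => μ)) (f := fun p : ℕ × List ℕ => p.1 :: p.2)
    (fun p q h => by simpa [Prod.ext_iff] using h)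
  have h2 := Measure.infinitePi_map_curry (fun (_ : ℕ) (ν : List ℕ) =>
    ((shift ξ ((ν.length : ℤ) + 1) : ProbabilityMeasure ℕ) : Measure ℕ).prod
      (Measure.infinitePi fun _ : ℕ => μ))
  rw [show (fun _ : ℕ => quenchedLaw μ (shift ξ)) = fun _ : ℕ => Measure.infinitePi
    fun ν : List ℕ => ((shift ξ ((ν.length : ℤ) + 1) : ProbabilityMeasure ℕ) : Measure ℕ).prod
      (Measure.infinitePi fun _ : ℕ => μ) from rfl, ← h2]
  have h3 : (fun p : ℕ × List ℕ => ((shift ξ ((p.2.length : ℤ) + 1) : ProbabilityMeasure ℕ) :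
      Measure ℕ).prod (Measure.infinitePi fun _ : ℕ => μ)) = fun p : ℕ × List ℕ =>
      ((ξ (((p.1 :: p.2).length : ℤ) + 1) : ProbabilityMeasure ℕ) : Measure ℕ).prod
      (Measure.infinitePi fun _ : ℕ => μ) := by
    funext p; simp [shift]
  rw [h3, ← h1, Measure.map_map (by fun_prop) (by fun_prop)]
  rfl

lemma indepFun_root_subtree (ξ : Environment) :
    IndepFun (fun ω : Marks => ω []) (fun ω i => subtree ω i) (quenchedLaw μ ξ) := by
  have h := iIndepFun_infinitePi (X := fun (_ : List ℕ) (z : ℕ × (ℕ → ℤ)) => z)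
    (P := fun ν : List ℕ => ((ξ ((ν.length : ℤ) + 1) : ProbabilityMeasure ℕ) : Measure ℕ).prod
      (Measure.infinitePi fun _ : ℕ => μ)) (fun _ => measurable_id)
  have h' := indep_iSup_of_disjoint (fun i => (measurable_pi_apply i).comap_le) h
    (S := {[]}) (T := {[]}ᶜ) disjoint_compl_right
  rw [IndepFun_iff_Indep]
  refine indep_of_indep_of_le_right (indep_of_indep_of_le_left h' ?_) ?_
  · exact le_iSup₂_of_le (f := fun (i : List ℕ) (_ : i ∈ ({[]} : Set (List ℕ))) =>
      MeasurableSpace.comap (fun ω : Marks => ω i) inferInstance) [] rfl le_rfl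
  · rw [← measurable_iff_comap_le]
    refine @measurable_pi_lambda _ _ _ (_) _ _ fun i =>
      @measurable_pi_lambda _ _ _ (_) _ _ fun ν => ?_
    rw [measurable_iff_comap_le]
    exact le_iSup₂_of_le (f := fun (i : List ℕ) (_ : i ∈ ({[]}ᶜ : Set (List ℕ))) =>
      MeasurableSpace.comap (fun ω : Marks => ω i) inferInstance) (i :: ν) (by simp) le_rfl

/-- The branching property: the mark of the root and the trees of descendants of its children
are independent. -/
lemma map_root_subtree_quenchedLaw (ξ : Environment) :
    (quenchedLaw μ ξ).map (fun ω => (ω [], fun i => subtree ω i)) =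
      (((ξ 1 : ProbabilityMeasure ℕ) : Measure ℕ).prod (Measure.infinitePi fun _ : ℕ => μ)).prod
        (Measure.infinitePi fun _ : ℕ => quenchedLaw μ (shift ξ)) := by
  rw [(indepFun_iff_map_prod_eq_prod_map_map (measurable_pi_apply _).aemeasurable
    (measurable_pi_lambda _ measurable_subtree).aemeasurable).1 (indepFun_root_subtree μ ξ),
    map_subtree_quenchedLaw]
  congr 1
  have := Measure.infinitePi_map_eval (fun ν : List ℕ =>
    ((ξ ((ν.length : ℤ) + 1) : ProbabilityMeasure ℕ) : Measure ℕ).prod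
      (Measure.infinitePi fun _ : ℕ => μ)) []
  simpa [quenchedLaw] using this

lemma lintegral_prod_infinitePi (f : ℤ → ℝ≥0∞) (k : ℕ) :
    ∫⁻ d, ∏ i ∈ Finset.range k, f (d i) ∂(Measure.infinitePi fun _ : ℕ => μ) =
      (∫⁻ h, f h ∂μ) ^ k := by
  have h := (iIndepFun_infinitePi (P := fun _ : ℕ => μ) (X := fun _ => f)
    (fun _ => measurable_of_countable f)).precomp (g := fun i : Fin k => (i : ℕ))
      Fin.val_injective
  have h2 := lintegral_prod_eq_prod_lintegral_of_indepFun (μ := Measure.infinitePi fun _ : ℕ => μ)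
    (Finset.univ : Finset (Fin k)) (fun (i : Fin k) (d : ℕ → ℤ) => f (d i)) h
    (fun i => (measurable_of_countable f).comp (measurable_pi_apply _))
  simp only [Finset.prod_range]
  rw [h2]
  have h3 (i : ℕ) : ∫⁻ d : ℕ → ℤ, f (d i) ∂(Measure.infinitePi fun _ : ℕ => μ) = ∫⁻ h, f h ∂μ := by
    rw [← lintegral_map (μ := Measure.infinitePi fun _ : ℕ => μ) (f := f)
      (measurable_of_countable f) (measurable_pi_apply i), Measure.infinitePi_map_eval]
  simp [h3]

/-- Conditioning on the mark of the root: the probability that no particle of the first `n + 1`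
generations gets to `x` is the generating function of the offspring law of the root at the
probability that the descendants of a single child do not get there. -/
lemma quenchedLaw_compl_reach_succ (ξ : Environment) (n : ℕ) {x : ℤ} (hx : 0 < x) :
    quenchedLaw μ ξ (reach (n + 1) x)ᶜ =
      ∫⁻ k, (∫⁻ h, quenchedLaw μ (shift ξ) (reach n (x - h))ᶜ ∂μ) ^ k ∂(ξ 1 : Measure ℕ) := by
  set T : Set ((ℕ × (ℕ → ℤ)) × (ℕ → Marks)) :=
    {p | ∀ i < p.1.1, p.2 i ∈ (reach n (x - p.1.2 i))ᶜ} with hT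
  have hTm : MeasurableSet T := by
    have : T = ⋂ i : ℕ, ⋂ d : ℤ, {p | p.1.2 i = d → i < p.1.1 → p.2 i ∈ (reach n (x - d))ᶜ} := by
      ext p
      simp [hT]
    rw [this]
    refine .iInter fun i => .iInter fun d => .imp ?_ (.imp ?_ ?_)
    · exact measurableSet_eq_fun (f := fun p : (ℕ × (ℕ → ℤ)) × (ℕ → Marks) => p.1.2 i)
        (by fun_prop) measurable_const
    · exact measurableSet_lt (f := fun p : (ℕ × (ℕ → ℤ)) × (ℕ → Marks) => i)
        measurable_const (by fun_prop)
    · exact (measurable_pi_apply i).comp measurable_snd (measurableSet_reach n (x - d)).compl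
  have hpre : (reach (n + 1) x)ᶜ = (fun ω : Marks => (ω [], fun i => subtree ω i)) ⁻¹' T := by
    ext ω
    simp [hT, mem_reach_succ ω n hx]
  rw [hpre, ← Measure.map_apply ((measurable_pi_apply _).prodMk
    (measurable_pi_lambda _ measurable_subtree)) hTm, map_root_subtree_quenchedLaw,
    Measure.prod_apply hTm]
  have hin (z : ℕ × (ℕ → ℤ)) :
      (Measure.infinitePi fun _ : ℕ => quenchedLaw μ (shift ξ)) (Prod.mk z ⁻¹' T) =
        ∏ i ∈ Finset.range z.1, quenchedLaw μ (shift ξ) (reach n (x - z.2 i))ᶜ := by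
    rw [← Measure.infinitePi_pi (fun _ : ℕ => quenchedLaw μ (shift ξ))
      (t := fun i => (reach n (x - z.2 i))ᶜ) fun i _ => (measurableSet_reach _ _).compl]
    congr 1
    ext w
    simp [hT, Set.mem_pi]
  simp only [hin]
  rw [lintegral_prod]
  · exact lintegral_congr fun k => lintegral_prod_infinitePi μ
      (fun h => quenchedLaw μ (shift ξ) (reach n (x - h))ᶜ) k
  · refine (measurable_from_prod_countable_right fun k => ?_).aemeasurable
    exact Finset.measurable_prod (Finset.range k)
      (f := fun i (d : ℕ → ℤ) => quenchedLaw μ (shift ξ) (reach n (x - d i))ᶜ) fun i _ =>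
        (measurable_of_countable (fun h => quenchedLaw μ (shift ξ) (reach n (x - h))ᶜ)).comp
          (measurable_pi_apply i)

lemma reachProb_le_one (ξ : Environment) (n : ℕ) (x : ℤ) : reachProb μ ξ n x ≤ 1 :=
  measureReal_le_one

lemma reachProb_of_nonpos (ξ : Environment) (n : ℕ) {x : ℤ} (hx : x ≤ 0) :
    reachProb μ ξ n x = 1 := by
  rw [reachProb, show reach n x = Set.univ from
    Set.eq_univ_of_forall fun ω => mem_reach_of_nonpos ω _ hx, probReal_univ]

lemma integrable_reachProb (ξ : Environment) (n : ℕ) (x : ℤ) :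
    Integrable (fun h : ℤ => reachProb μ ξ n (x - h)) μ :=
  .of_bound (measurable_of_countable _).aestronglyMeasurable 1 (.of_forall fun h => by
    rw [Real.norm_of_nonneg (reachProb_nonneg ..)]; exact reachProb_le_one ..)

lemma childReachProb_le_one (ξ : Environment) (n : ℕ) (x : ℤ) : childReachProb μ ξ n x ≤ 1 := by
  have := integral_mono (integrable_reachProb μ (shift ξ) n x) (integrable_const 1)
    fun h => reachProb_le_one μ (shift ξ) n (x - h)
  simpa [childReachProb] using this

lemma reachProb_succ (ξ : Environment) (n : ℕ) {x : ℤ} (hx : 0 < x) :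
    reachProb μ ξ (n + 1) x =
      ∫ k, (1 - (1 - childReachProb μ ξ n x) ^ k) ∂(ξ 1 : Measure ℕ) := by
  have hs0 := childReachProb_nonneg μ ξ n x
  have hs1 := childReachProb_le_one μ ξ n x
  have hs : ∫⁻ h, quenchedLaw μ (shift ξ) (reach n (x - h))ᶜ ∂μ =
      ENNReal.ofReal (1 - childReachProb μ ξ n x) := by
    have h1 (h : ℤ) : quenchedLaw μ (shift ξ) (reach n (x - h))ᶜ =
        ENNReal.ofReal (1 - reachProb μ (shift ξ) n (x - h)) := by
      rw [reachProb, ← probReal_compl_eq_one_sub (measurableSet_reach _ _), ofReal_measureReal]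
    simp only [h1]
    rw [← ofReal_integral_eq_lintegral_ofReal
      (f := fun h => 1 - reachProb μ (shift ξ) n (x - h)) ((integrable_const 1).sub
      (integrable_reachProb μ (shift ξ) n x)) (.of_forall fun h =>
        sub_nonneg.2 (reachProb_le_one ..)), integral_sub (integrable_const 1)
      (integrable_reachProb μ (shift ξ) n x)]
    simp [childReachProb]
  have hpow : Integrable (fun k : ℕ => (1 - childReachProb μ ξ n x) ^ k) (ξ 1 : Measure ℕ) :=
    .of_bound (measurable_of_countable _).aestronglyMeasurable 1 (.of_forall fun k => by
      rw [Real.norm_of_nonneg (pow_nonneg (by linarith) k)]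
      exact pow_le_one₀ (by linarith) (by linarith))
  have key := quenchedLaw_compl_reach_succ μ ξ n hx
  simp only [hs, ← ENNReal.ofReal_pow (sub_nonneg.2 hs1)] at key
  rw [← ofReal_integral_eq_lintegral_ofReal hpow (.of_forall fun k =>
    pow_nonneg (sub_nonneg.2 hs1) k)] at key
  rw [integral_sub (integrable_const 1) hpow]
  have h2 : (quenchedLaw μ ξ).real (reach (n + 1) x)ᶜ =
      ∫ k, (1 - childReachProb μ ξ n x) ^ k ∂(ξ 1 : Measure ℕ) := by
    rw [measureReal_def, key, ENNReal.toReal_ofReal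
      (integral_nonneg fun k => pow_nonneg (sub_nonneg.2 hs1) k)]
  rw [probReal_compl_eq_one_sub (measurableSet_reach _ _)] at h2
  simp [← h2, reachProb]

end

/-! ### One generation: bounds for the generating function -/

section OffspringMoments

variable (F : ProbabilityMeasure ℕ)

lemma lintegral_natCast_eq_offspringMean :
    ∫⁻ k, (k : ℝ≥0∞) ∂(F : Measure ℕ) = offspringMean F := by
  rw [lintegral_countable', offspringMean]

variable {F}

lemma integrable_natCast (hF : offspringMean F ≠ ∞) :
    Integrable (fun k : ℕ => (k : ℝ)) (F : Measure ℕ) := by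
  refine ⟨(measurable_of_countable _).aestronglyMeasurable, ?_⟩
  rw [hasFiniteIntegral_iff_ofReal (.of_forall fun k => Nat.cast_nonneg k)]
  simpa [lintegral_natCast_eq_offspringMean] using hF.lt_top

lemma integral_natCast : ∫ k, (k : ℝ) ∂(F : Measure ℕ) = (offspringMean F).toReal := by
  rw [integral_eq_lintegral_of_nonneg_ae (.of_forall fun k => Nat.cast_nonneg k)
    (measurable_of_countable _).aestronglyMeasurable]
  simp [lintegral_natCast_eq_offspringMean]

lemma exp_logMean (h0 : offspringMean F ≠ 0) (h1 : offspringMean F ≠ ∞) :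
    Real.exp (logMean F) = (offspringMean F).toReal :=
  Real.exp_log (ENNReal.toReal_pos h0 h1)

lemma lintegral_factorial (h0 : offspringMean F ≠ 0) (h1 : offspringMean F ≠ ∞) :
    ∫⁻ k : ℕ, ((k * (k - 1) : ℕ) : ℝ≥0∞) ∂(F : Measure ℕ) =
      normalizedFactorialMoment F * offspringMean F ^ 2 := by
  rw [lintegral_countable', normalizedFactorialMoment, ENNReal.div_mul_cancel]
  · exact pow_ne_zero 2 h0
  · exact ENNReal.pow_ne_top h1

lemma integrable_factorial (h0 : offspringMean F ≠ 0) (h1 : offspringMean F ≠ ∞)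
    (hη : normalizedFactorialMoment F ≠ ∞) :
    Integrable (fun k : ℕ => ((k * (k - 1) : ℕ) : ℝ)) (F : Measure ℕ) := by
  refine ⟨(measurable_of_countable _).aestronglyMeasurable, ?_⟩
  rw [hasFiniteIntegral_iff_ofReal (.of_forall fun k => Nat.cast_nonneg _)]
  simp only [ENNReal.ofReal_natCast, lintegral_factorial h0 h1]
  exact ENNReal.mul_lt_top hη.lt_top (ENNReal.pow_lt_top h1.lt_top)

lemma integral_factorial (h0 : offspringMean F ≠ 0) (h1 : offspringMean F ≠ ∞) :
    ∫ k : ℕ, ((k * (k - 1) : ℕ) : ℝ) ∂(F : Measure ℕ) =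
      (normalizedFactorialMoment F).toReal * (offspringMean F).toReal ^ 2 := by
  rw [integral_eq_lintegral_of_nonneg_ae (.of_forall fun k => Nat.cast_nonneg _)
    (measurable_of_countable _).aestronglyMeasurable]
  simp only [ENNReal.ofReal_natCast, lintegral_factorial h0 h1, ENNReal.toReal_mul,
    ENNReal.toReal_pow]

lemma integrable_one_sub_pow {s : ℝ} (hs0 : 0 ≤ s) (hs1 : s ≤ 1) :
    Integrable (fun k : ℕ => 1 - (1 - s) ^ k) (F : Measure ℕ) :=
  .of_bound (measurable_of_countable _).aestronglyMeasurable 1 (.of_forall fun k => by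
    have h1 : (1 - s) ^ k ≤ 1 := pow_le_one₀ (by linarith) (by linarith)
    have h2 : 0 ≤ (1 - s) ^ k := pow_nonneg (by linarith) k
    rw [Real.norm_of_nonneg (by linarith)]
    linarith)

lemma integral_one_sub_pow_le (h1 : offspringMean F ≠ ∞) {s : ℝ} (hs0 : 0 ≤ s) (hs1 : s ≤ 1) :
    ∫ k, (1 - (1 - s) ^ k) ∂(F : Measure ℕ) ≤ (offspringMean F).toReal * s := by
  rw [← integral_natCast, ← integral_mul_const]
  refine integral_mono (integrable_one_sub_pow hs0 hs1) ((integrable_natCast h1).mul_const s)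
    fun k => ?_
  have := one_add_mul_le_pow (a := -s) (by linarith) k
  simp only [← sub_eq_add_neg] at this
  simp only
  linarith

/-- For a binomial variable `N` with parameters `k` and `s`, this is the expectation of the
inequality `1{N ≠ 0} ≥ 2 c N - c ^ 2 N ^ 2`. -/
lemma le_one_sub_pow {s : ℝ} (hs0 : 0 ≤ s) (hs1 : s ≤ 1) (c : ℝ) (k : ℕ) :
    2 * c * s * k - c ^ 2 * (s * k + s ^ 2 * ((k * (k - 1) : ℕ) : ℝ)) ≤ 1 - (1 - s) ^ k := by
  cases k with
  | zero => simp
  | succ n =>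
    push_cast [Nat.add_sub_cancel]
    have h1 : 1 + (n : ℝ) * s ≤ (1 + s) ^ n := one_add_mul_le_pow (by linarith) n
    have h2 : (1 - s) ^ n * (1 + n * s) ≤ 1 := by
      calc (1 - s) ^ n * (1 + n * s) ≤ (1 - s) ^ n * (1 + s) ^ n :=
            mul_le_mul_of_nonneg_left h1 (pow_nonneg (by linarith) n)
        _ = (1 - s ^ 2) ^ n := by rw [← mul_pow]; ring
        _ ≤ 1 := pow_le_one₀ (by nlinarith) (by nlinarith)
    have hD : 0 < 1 + (n : ℝ) * s := by positivity
    have h3 : (n + 1 : ℝ) * s ≤ (1 - (1 - s) ^ (n + 1)) * (1 + n * s) := by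
      rw [pow_succ]
      nlinarith [mul_le_mul_of_nonneg_left h2 (sub_nonneg.2 hs1)]
    refine le_of_mul_le_mul_right ?_ hD
    refine le_trans ?_ h3
    have h4 : 0 ≤ (n + 1 : ℝ) * s * (1 - c * (1 + n * s)) ^ 2 := by positivity
    nlinarith [h4]

/-- The second moment bound for a single generation. -/
lemma le_integral_one_sub_pow (h0 : offspringMean F ≠ 0) (h1 : offspringMean F ≠ ∞)
    (hη : normalizedFactorialMoment F ≠ ∞) {s : ℝ} (hs0 : 0 ≤ s) (hs1 : s ≤ 1) :
    (offspringMean F).toReal * s ≤ (∫ k, (1 - (1 - s) ^ k) ∂(F : Measure ℕ)) *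
      (1 + (offspringMean F).toReal * s * (normalizedFactorialMoment F).toReal) := by
  set m := (offspringMean F).toReal with hm
  set η := (normalizedFactorialMoment F).toReal with hη'
  have hm0 : 0 ≤ m := ENNReal.toReal_nonneg
  have hη0 : 0 ≤ η := ENNReal.toReal_nonneg
  have hD : 0 < 1 + m * s * η := by positivity
  -- this value of `c` maximizes the quadratic lower bound
  set c := (1 + m * s * η)⁻¹ with hc
  have hcD : c * (1 + m * s * η) = 1 := inv_mul_cancel₀ hD.ne'
  have i1 := (integrable_natCast h1).const_mul (2 * c * s)
  have i2 : Integrable (fun k : ℕ => s * (k : ℝ) + s ^ 2 * ((k * (k - 1) : ℕ) : ℝ))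
      (F : Measure ℕ) := ((integrable_natCast h1).const_mul s).add
    ((integrable_factorial h0 h1 hη).const_mul (s ^ 2))
  have key := integral_mono (i1.sub (i2.const_mul (c ^ 2)))
    (integrable_one_sub_pow (F := F) hs0 hs1) (fun k => le_one_sub_pow hs0 hs1 c k)
  have e : ∫ k : ℕ, (2 * c * s * (k : ℝ) - c ^ 2 * (s * k + s ^ 2 * ((k * (k - 1) : ℕ) : ℝ)))
      ∂(F : Measure ℕ) = 2 * c * s * m - c ^ 2 * (s * m + s ^ 2 * (η * m ^ 2)) := by
    rw [integral_sub i1 (i2.const_mul (c ^ 2)), integral_const_mul, integral_const_mul,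
      integral_add ((integrable_natCast h1).const_mul s)
      ((integrable_factorial h0 h1 hη).const_mul (s ^ 2)), integral_const_mul, integral_const_mul,
      integral_natCast, integral_factorial h0 h1]
  have key2 : 2 * c * s * m - c ^ 2 * (s * m + s ^ 2 * (η * m ^ 2)) ≤
      ∫ k, (1 - (1 - s) ^ k) ∂(F : Measure ℕ) := e ▸ key
  have e2 : 2 * c * s * m - c ^ 2 * (s * m + s ^ 2 * (η * m ^ 2)) = c * (m * s) := by
    linear_combination (-c * m * s) * hcD
  rw [e2] at key2
  calc m * s = c * (m * s) * (1 + m * s * η) := by linear_combination (-m * s) * hcD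
    _ ≤ _ := mul_le_mul_of_nonneg_right key2 hD.le

end OffspringMoments

/-! ### The jump law -/

section Jump

lemma ae_le_one {μ : Measure ℤ} (hμ : JumpAssumption μ) : ∀ᵐ h ∂μ, h ≤ (1 : ℤ) := by
  rw [ae_iff]
  convert hμ.no_overshoot using 2
  ext h
  simp only [Set.mem_ofPred_eq, Set.mem_Ici]
  omega

lemma exp_mul_le {μ : Measure ℤ} (hμ : JumpAssumption μ) {l : ℝ} (hl : 0 ≤ l) :
    ∀ᵐ h : ℤ ∂μ, Real.exp (l * h) ≤ Real.exp l := by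
  filter_upwards [ae_le_one hμ] with h hh
  have : (h : ℝ) ≤ 1 := by exact_mod_cast hh
  exact Real.exp_le_exp.2 (by nlinarith)

lemma integrable_mul_exp_mul {μ : Measure ℤ} (hμ : JumpAssumption μ) {l : ℝ} (hl : 0 ≤ l) :
    Integrable (fun h : ℤ => (h : ℝ) * Real.exp (l * h)) μ :=
  hμ.integrable.mul_bdd (c := Real.exp l) (measurable_of_countable _).aestronglyMeasurable (by
    filter_upwards [exp_mul_le hμ hl] with h hh
    rwa [Real.norm_of_nonneg (Real.exp_pos _).le])

variable {μ : Measure ℤ} [IsProbabilityMeasure μ]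

/-- The Laplace transform of the jump law. -/
def jumpLaplace (μ : Measure ℤ) (l : ℝ) : ℝ := ∫ h : ℤ, Real.exp (l * h) ∂μ

lemma jumpLogLaplace_eq (μ : Measure ℤ) (l : ℝ) :
    jumpLogLaplace μ l = Real.log (jumpLaplace μ l) := rfl

lemma integrable_exp_mul (hμ : JumpAssumption μ) {l : ℝ} (hl : 0 ≤ l) :
    Integrable (fun h : ℤ => Real.exp (l * h)) μ :=
  .of_bound (measurable_of_countable _).aestronglyMeasurable (Real.exp l) (by
    filter_upwards [exp_mul_le hμ hl] with h hh
    rwa [Real.norm_of_nonneg (Real.exp_pos _).le])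

lemma one_le_jumpLaplace (hμ : JumpAssumption μ) {l : ℝ} (hl : 0 ≤ l) : 1 ≤ jumpLaplace μ l := by
  have := integral_mono ((hμ.integrable.const_mul l).add (integrable_const 1))
    (integrable_exp_mul hμ hl) fun h => Real.add_one_le_exp (l * h)
  have e : ∫ h : ℤ, (l * (h : ℝ) + 1) ∂μ = 1 := by
    rw [integral_add (hμ.integrable.const_mul l) (integrable_const 1), integral_const_mul,
      hμ.mean_zero]
    simp
  exact e ▸ this

lemma jumpLaplace_convex (hμ : JumpAssumption μ) {l : ℝ} (hl : 0 ≤ l) {t : ℝ} (ht0 : 0 ≤ t)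
    (ht1 : t ≤ 1) : jumpLaplace μ (t * l) ≤ 1 - t + t * jumpLaplace μ l := by
  have h1 := integral_mono (integrable_exp_mul hμ (mul_nonneg ht0 hl))
    ((integrable_const (1 - t)).add ((integrable_exp_mul hμ hl).const_mul t)) (fun h => by
      have := convexOn_exp.2 (Set.mem_univ (0 : ℝ)) (Set.mem_univ (l * (h : ℝ)))
        (sub_nonneg.2 ht1) ht0 (by ring)
      simpa [mul_assoc] using this)
  have e : ∫ h : ℤ, (1 - t + t * Real.exp (l * h)) ∂μ = 1 - t + t * jumpLaplace μ l := by
    rw [integral_add (integrable_const _) ((integrable_exp_mul hμ hl).const_mul t),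
      integral_const_mul]
    simp [jumpLaplace]
  exact e ▸ h1

lemma jumpLaplace_lt_of_lt (hμ : JumpAssumption μ) {l l' : ℝ} (hl : 0 < l) (hll : l < l')
    (h1 : 1 < jumpLaplace μ l') : jumpLaplace μ l < jumpLaplace μ l' := by
  have hl' : 0 < l' := hl.trans hll
  have ht : l / l' < 1 := (div_lt_one hl').2 hll
  have := jumpLaplace_convex hμ hl'.le (div_nonneg hl.le hl'.le) ht.le
  rw [div_mul_cancel₀ _ hl'.ne'] at this
  nlinarith

lemma measureReal_one_pos (hμ : JumpAssumption μ) : 0 < μ.real {1} := by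
  by_contra hcon
  have h0 : μ {1} = 0 := by
    have : μ.real {1} = 0 := le_antisymm (not_lt.1 hcon) measureReal_nonneg
    exact (measureReal_eq_zero_iff).1 this
  have h1 : ∀ᵐ h ∂μ, h ≤ (0 : ℤ) := by
    have : ∀ᵐ h ∂μ, h ≠ (1 : ℤ) := by rw [ae_iff]; simpa using h0
    filter_upwards [this, ae_le_one hμ] with h h2 h3
    omega
  have h2 : (fun h : ℤ => -(h : ℝ)) =ᵐ[μ] 0 := by
    rw [← integral_eq_zero_iff_of_nonneg_ae (f := fun h : ℤ => -(h : ℝ)) _ hμ.integrable.neg]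
    · rw [integral_neg, hμ.mean_zero, neg_zero]
    · filter_upwards [h1] with h hh
      have : (h : ℝ) ≤ 0 := by exact_mod_cast hh
      simpa using this
  apply hμ.nontrivial 0
  have h3 : ∀ᵐ h ∂μ, id h = (0 : ℤ) := by
    filter_upwards [h2] with h hh
    simpa using hh
  have h4 : μ.map id = Measure.dirac 0 := by
    rw [Measure.map_congr h3, Measure.map_const]
    simp
  rwa [Measure.map_id] at h4

lemma exp_mul_measureReal_le (hμ : JumpAssumption μ) {l : ℝ} (hl : 0 ≤ l) :
    Real.exp l * μ.real {1} ≤ jumpLaplace μ l := by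
  have h1 := setIntegral_le_integral (s := {1}) (integrable_exp_mul hμ hl)
    (.of_forall fun h => (Real.exp_pos _).le)
  rw [integral_singleton] at h1
  simpa [mul_comm, jumpLaplace] using h1

lemma continuousOn_jumpLaplace (hμ : JumpAssumption μ) (L : ℝ) :
    ContinuousOn (jumpLaplace μ) (Set.Icc 0 L) := by
  refine continuousOn_of_dominated (bound := fun _ => Real.exp L)
    (fun l _ => (measurable_of_countable _).aestronglyMeasurable) (fun l hl => ?_)
    (integrable_const _) (.of_forall fun h => by fun_prop)
  filter_upwards [exp_mul_le hμ hl.1] with h hh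
  rw [Real.norm_of_nonneg (Real.exp_pos _).le]
  exact hh.trans (Real.exp_le_exp.2 hl.2)

lemma exists_jumpLaplace_eq (hμ : JumpAssumption μ) {c : ℝ} (hc : 1 < c) :
    ∃ l, 0 < l ∧ jumpLaplace μ l = c := by
  have hp := measureReal_one_pos hμ
  set L := c / μ.real {1} with hL
  have hL0 : 0 < L := by positivity
  have h0 : jumpLaplace μ 0 = 1 := by simp [jumpLaplace]
  have hLc : c ≤ jumpLaplace μ L := by
    refine le_trans ?_ (exp_mul_measureReal_le hμ hL0.le)
    calc c = L * μ.real {1} := by rw [hL, div_mul_cancel₀ _ hp.ne']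
      _ ≤ _ := mul_le_mul_of_nonneg_right
        ((le_add_of_nonneg_right zero_le_one).trans (Real.add_one_le_exp L)) hp.le
  obtain ⟨l, hl, hlc⟩ := intermediate_value_Icc hL0.le (continuousOn_jumpLaplace hμ L)
    (show c ∈ Set.Icc _ _ from ⟨h0 ▸ hc.le, hLc⟩)
  refine ⟨l, lt_of_le_of_ne hl.1 ?_, hlc⟩
  rintro rfl
  linarith

/-- The drift of the walk with the exponentially tilted jump law `e ^ (l h) μ(h) / φ(l)`, where
`φ` is the Laplace transform. -/
def tiltedDrift (μ : Measure ℤ) (l : ℝ) : ℝ :=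
  (∫ h : ℤ, (h : ℝ) * Real.exp (l * h) ∂μ) / jumpLaplace μ l

lemma tiltedDrift_pos (hμ : JumpAssumption μ) {l : ℝ} (hl : 0 < l) (h1 : 1 < jumpLaplace μ l) :
    0 < tiltedDrift μ l := by
  refine div_pos ?_ (by linarith)
  have := integral_mono ((integrable_exp_mul hμ hl.le).sub (integrable_const 1))
    ((integrable_mul_exp_mul hμ hl.le).const_mul l) (fun h => by
      have h2 := Real.add_one_le_exp (-(l * (h : ℝ)))
      have h3 : Real.exp (-(l * (h : ℝ))) * Real.exp (l * h) = 1 := by rw [← Real.exp_add]; simp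
      have h4 := Real.exp_pos (l * (h : ℝ))
      simp only [Pi.sub_apply]
      nlinarith)
  have e : ∫ h : ℤ, (Real.exp (l * h) - 1) ∂μ = jumpLaplace μ l - 1 := by
    rw [integral_sub (integrable_exp_mul hμ hl.le) (integrable_const 1)]
    simp [jumpLaplace]
  rw [integral_const_mul] at this
  have h5 : jumpLaplace μ l - 1 ≤ l * ∫ h : ℤ, (h : ℝ) * Real.exp (l * h) ∂μ := e ▸ this
  exact pos_of_mul_pos_right (lt_of_lt_of_le (by linarith) h5) hl.le

lemma tiltedDrift_le_one (hμ : JumpAssumption μ) {l : ℝ} (hl : 0 ≤ l) : tiltedDrift μ l ≤ 1 := by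
  refine (div_le_one (by linarith [one_le_jumpLaplace hμ hl])).2 ?_
  refine integral_mono_ae (integrable_mul_exp_mul hμ hl) (integrable_exp_mul hμ hl) ?_
  filter_upwards [ae_le_one hμ] with h hh
  have : (h : ℝ) ≤ 1 := by exact_mod_cast hh
  exact mul_le_of_le_one_left (Real.exp_pos _).le this

end Jump

/-! ### Bounds for the probability of getting to a level in a given environment -/

/-- Environments all of whose offspring laws have a mean in `(0, ∞)` and a finite second factorial
moment. -/
structure NondegenerateEnvironment (ξ : Environment) : Prop where
  mean_ne_zero : ∀ k, offspringMean (ξ k) ≠ 0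
  mean_ne_top : ∀ k, offspringMean (ξ k) ≠ ∞
  moment_ne_top : ∀ k, normalizedFactorialMoment (ξ k) ≠ ∞

lemma NondegenerateEnvironment.shift {ξ : Environment} (h : NondegenerateEnvironment ξ) :
    NondegenerateEnvironment (shift ξ) :=
  ⟨fun k => h.1 (k + 1), fun k => h.2 (k + 1), fun k => h.3 (k + 1)⟩

/-- The random walk `X_1 + ⋯ + X_n` associated with the environment. -/
def envWalk (ξ : Environment) (n : ℕ) : ℝ := ∑ i ∈ Finset.range n, logMean (ξ (i + 1))

/-- The sum `η_1 + ⋯ + η_n` of the normalized second factorial moments. -/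
def envMoment (ξ : Environment) (n : ℕ) : ℝ :=
  ∑ i ∈ Finset.range n, (normalizedFactorialMoment (ξ (i + 1))).toReal

lemma envWalk_succ (ξ : Environment) (n : ℕ) :
    envWalk ξ (n + 1) = logMean (ξ 1) + envWalk (shift ξ) n := by
  rw [envWalk, Finset.sum_range_succ', add_comm]
  simp [envWalk, shift]

lemma envMoment_succ (ξ : Environment) (n : ℕ) :
    envMoment ξ (n + 1) =
      (normalizedFactorialMoment (ξ 1)).toReal + envMoment (shift ξ) n := by
  rw [envMoment, Finset.sum_range_succ', add_comm]
  simp [envMoment, shift]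

lemma envMoment_nonneg (ξ : Environment) (n : ℕ) : 0 ≤ envMoment ξ n :=
  Finset.sum_nonneg fun _ _ => ENNReal.toReal_nonneg

/-- The quenched expectation of `∑ e ^ (l * position)` over the particles of generation `n`. -/
def laplaceMean (μ : Measure ℤ) (l : ℝ) (ξ : Environment) (n : ℕ) : ℝ :=
  Real.exp (envWalk ξ n) * jumpLaplace μ l ^ n

lemma laplaceMean_zero (μ : Measure ℤ) (l : ℝ) (ξ : Environment) : laplaceMean μ l ξ 0 = 1 := by
  simp [laplaceMean, envWalk]

lemma laplaceMean_succ (μ : Measure ℤ) (l : ℝ) (ξ : Environment) (n : ℕ) :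
    laplaceMean μ l ξ (n + 1) =
      Real.exp (logMean (ξ 1)) * jumpLaplace μ l * laplaceMean μ l (shift ξ) n := by
  simp only [laplaceMean, envWalk_succ, Real.exp_add, pow_succ]
  ring

section

variable {μ : Measure ℤ} [IsProbabilityMeasure μ] {l : ℝ} {ξ : Environment}

lemma laplaceMean_pos (hμ : JumpAssumption μ) (hl : 0 ≤ l) (ξ : Environment) (n : ℕ) :
    0 < laplaceMean μ l ξ n :=
  mul_pos (Real.exp_pos _) (pow_pos (by linarith [one_le_jumpLaplace hμ hl]) n)

/-- The first moment bound. -/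
lemma reachProb_le (hμ : JumpAssumption μ) (hl : 0 ≤ l) (hξ : NondegenerateEnvironment ξ) (n : ℕ)
    (x : ℤ) :
    reachProb μ ξ n x ≤
      Real.exp (-(l * x)) * ∑ j ∈ Finset.range (n + 1), laplaceMean μ l ξ j := by
  have hsum (ξ : Environment) (n : ℕ) : 1 ≤ ∑ j ∈ Finset.range (n + 1), laplaceMean μ l ξ j := by
    rw [Finset.sum_range_succ', laplaceMean_zero]
    exact le_add_of_nonneg_left (Finset.sum_nonneg fun j _ => (laplaceMean_pos hμ hl ξ _).le)
  have hneg (ξ : Environment) (n : ℕ) {x : ℤ} (hx : x ≤ 0) : reachProb μ ξ n x ≤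
      Real.exp (-(l * x)) * ∑ j ∈ Finset.range (n + 1), laplaceMean μ l ξ j := by
    rw [reachProb_of_nonpos μ ξ n hx]
    have hx' : (x : ℝ) ≤ 0 := by exact_mod_cast hx
    exact one_le_mul_of_one_le_of_one_le (Real.one_le_exp (by nlinarith)) (hsum ξ n)
  induction n generalizing ξ x with
  | zero =>
    rcases le_or_gt x 0 with hx | hx
    · exact hneg ξ 0 hx
    · rw [reachProb_zero μ ξ hx]
      exact mul_nonneg (Real.exp_pos _).le (zero_le_one.trans (hsum ξ 0))
  | succ n ih =>
    rcases le_or_gt x 0 with hx | hx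
    · exact hneg ξ (n + 1) hx
    set A := ∑ j ∈ Finset.range (n + 1), laplaceMean μ l (shift ξ) j with hA
    have h1 : childReachProb μ ξ n x ≤ Real.exp (-(l * x)) * A * jumpLaplace μ l := by
      rw [childReachProb, jumpLaplace, ← integral_const_mul]
      refine integral_mono (integrable_reachProb μ (shift ξ) n x)
        ((integrable_exp_mul hμ hl).const_mul _) fun h => (ih hξ.shift (x - h)).trans_eq ?_
      rw [← hA, show -(l * ((x - h : ℤ) : ℝ)) = -(l * x) + l * h by push_cast; ring, Real.exp_add]
      ring
    rw [reachProb_succ μ ξ n hx]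
    refine (integral_one_sub_pow_le (hξ.mean_ne_top 1) (childReachProb_nonneg μ ξ n x)
      (childReachProb_le_one μ ξ n x)).trans ?_
    rw [Finset.sum_range_succ', laplaceMean_zero]
    simp only [laplaceMean_succ]
    rw [← Finset.mul_sum, ← hA, ← exp_logMean (hξ.mean_ne_zero 1) (hξ.mean_ne_top 1)]
    have h2 := mul_le_mul_of_nonneg_left h1 (Real.exp_pos (logMean (ξ 1))).le
    have h3 := Real.exp_pos (-(l * x))
    nlinarith

/-- The second moment bound. Let `v = tiltedDrift μ l` be the drift of the tilted walk. While the
remaining distance `x` is positive, the function on the left-hand side is equal to the mean offspring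
number times the average of its value for a child (for which `κ` is divided by `m φ(l)`). The
assumption `hκn` keeps it at most `1` until the level is reached. Hence the one-step inequality
`1 / r ≤ 1 / (m s) + η`, with `m` and `s` as in `le_integral_one_sub_pow`, propagates the bound
with a loss of one summand `η_k` per generation. -/
lemma le_reachProb (hμ : JumpAssumption μ) (hl : 0 ≤ l) (hξ : NondegenerateEnvironment ξ)
    {κ t : ℝ} (hκ : 0 ≤ κ) (ht : 0 ≤ t) (n : ℕ) (htn : t * n ≤ 1)
    (hκn : ∀ j ≤ n, κ ≤ laplaceMean μ l ξ j) {x : ℤ} (hx : 0 ≤ x) :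
    κ * Real.exp (-(l * x)) * (t * (tiltedDrift μ l * n - x)) ≤
      reachProb μ ξ n x * (1 + envMoment ξ n) := by
  have hv := tiltedDrift_le_one hμ hl
  set v := tiltedDrift μ l with hvdef
  have hx' : (0 : ℝ) ≤ x := by exact_mod_cast hx
  -- the left-hand side is at most one
  have hle {κ : ℝ} (hκ : 0 ≤ κ) (hκ1 : κ ≤ 1) {n : ℕ} (htn : t * n ≤ 1) {x : ℤ}
      (hx' : (0 : ℝ) ≤ x) : κ * Real.exp (-(l * x)) * (t * (v * n - x)) ≤ 1 := by
    have h1 : Real.exp (-(l * x)) ≤ 1 := Real.exp_le_one_iff.2 (by nlinarith)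
    have h2 : t * (v * n - x) ≤ 1 := by
      have : t * (v * n - x) ≤ t * n := mul_le_mul_of_nonneg_left
        (by nlinarith [(Nat.cast_nonneg n : (0 : ℝ) ≤ n)]) ht
      linarith
    have h3 : 0 ≤ κ * Real.exp (-(l * x)) := by positivity
    have h4 : κ * Real.exp (-(l * x)) ≤ 1 := mul_le_one₀ hκ1 (Real.exp_pos _).le h1
    nlinarith
  induction n generalizing ξ κ x with
  | zero =>
    refine le_trans ?_ (mul_nonneg (reachProb_nonneg ..)
      (add_nonneg zero_le_one (envMoment_nonneg ..)))
    refine mul_nonpos_of_nonneg_of_nonpos (by positivity) (mul_nonpos_of_nonneg_of_nonpos ht ?_)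
    simpa using hx
  | succ n ih =>
    have hκ1 : κ ≤ 1 := (hκn 0 (Nat.zero_le _)).trans_eq (laplaceMean_zero ..)
    have hH1 := hle hκ hκ1 htn hx'
    rcases hx.eq_or_lt with rfl | hxpos
    · rw [reachProb_of_nonpos μ ξ _ le_rfl]
      linarith [envMoment_nonneg ξ (n + 1)]
    set H := κ * Real.exp (-(l * x)) * (t * (v * (n + 1 : ℕ) - x)) with hH
    rcases le_or_gt H 0 with hH0 | hH0
    · exact hH0.trans (mul_nonneg (reachProb_nonneg ..)
        (add_nonneg zero_le_one (envMoment_nonneg ..)))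
    have hφ : 0 < jumpLaplace μ l := by linarith [one_le_jumpLaplace hμ hl]
    have hm : 0 < Real.exp (logMean (ξ 1)) := Real.exp_pos _
    set m := Real.exp (logMean (ξ 1)) with hmdef
    set φ := jumpLaplace μ l with hφdef
    set A := 1 + envMoment (shift ξ) n with hA
    have hA1 : 1 ≤ A := le_add_of_nonneg_right (envMoment_nonneg ..)
    set η := (normalizedFactorialMoment (ξ 1)).toReal with hη
    have hη0 : 0 ≤ η := ENNReal.toReal_nonneg
    set s := childReachProb μ ξ n x with hs
    have hs0 : 0 ≤ s := childReachProb_nonneg μ ξ n x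
    set κ' := κ / (m * φ) with hκ'
    have hκ'0 : 0 ≤ κ' := by positivity
    -- the induction hypothesis, integrated over the displacement of a child
    have hsA : κ' * Real.exp (-(l * x)) * t * (φ * (v * (n + 1) - x)) ≤ s * A := by
      have hpt : ∀ᵐ h : ℤ ∂μ, κ' * Real.exp (-(l * x)) * t *
          ((h : ℝ) * Real.exp (l * h) + (v * n - x) * Real.exp (l * h)) ≤
          reachProb μ (shift ξ) n (x - h) * A := by
        filter_upwards [ae_le_one hμ] with h hh
        have hxh : 0 ≤ x - h := by omega
        refine le_trans (le_of_eq ?_) (ih hξ.shift hκ'0 ?_ ?_ hxh (by exact_mod_cast hxh))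
        · rw [show -(l * ((x - h : ℤ) : ℝ)) = -(l * x) + l * h by push_cast; ring, Real.exp_add]
          push_cast
          ring
        · refine le_trans (mul_le_mul_of_nonneg_left ?_ ht) htn
          exact_mod_cast Nat.le_succ n
        · intro j hj
          have := hκn (j + 1) (by omega)
          rw [laplaceMean_succ] at this
          rw [hκ', div_le_iff₀ (by positivity)]
          linarith
      have i1 := integrable_mul_exp_mul hμ hl
      have i2 := (integrable_exp_mul hμ hl).const_mul (v * n - x)
      have := integral_mono_ae ((i1.add i2).const_mul (κ' * Real.exp (-(l * x)) * t))
        ((integrable_reachProb μ (shift ξ) n x).mul_const A) hpt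
      rw [integral_const_mul, integral_mul_const] at this
      have e : ∫ h : ℤ, ((h : ℝ) * Real.exp (l * h) + (v * n - x) * Real.exp (l * h)) ∂μ =
          φ * (v * (n + 1) - x) := by
        have hvφ : ∫ h : ℤ, (h : ℝ) * Real.exp (l * h) ∂μ = v * φ :=
          (div_mul_cancel₀ _ hφ.ne').symm
        rw [integral_add i1 i2, integral_const_mul, hvφ]
        simp only [hφdef, jumpLaplace]
        ring
      exact e ▸ this
    have hHs : H ≤ m * s * A := by
      have := mul_le_mul_of_nonneg_left hsA hm.le
      refine le_trans (le_of_eq ?_) (this.trans_eq (by ring))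
      rw [hH, hκ']
      push_cast
      field_simp
    have hstep := le_integral_one_sub_pow (hξ.mean_ne_zero 1) (hξ.mean_ne_top 1)
      (hξ.moment_ne_top 1) hs0 (childReachProb_le_one μ ξ n x)
    rw [← reachProb_succ μ ξ n hxpos, ← exp_logMean (hξ.mean_ne_zero 1) (hξ.mean_ne_top 1),
      ← hmdef, ← hη] at hstep
    rw [envMoment_succ, ← hη]
    set q := reachProb μ ξ (n + 1) x with hq
    have hD : 0 < 1 + m * s * η := by positivity
    refine le_of_mul_le_mul_right ?_ hD
    have h1 : 0 ≤ m * s * η := by positivity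
    have h2 : 0 ≤ A + η := by linarith
    calc H * (1 + m * s * η) = H + H * (m * s * η) := by ring
      _ ≤ m * s * A + 1 * (m * s * η) := add_le_add hHs (mul_le_mul_of_nonneg_right hH1 h1)
      _ = m * s * (A + η) := by ring
      _ ≤ q * (1 + m * s * η) * (A + η) := mul_le_mul_of_nonneg_right hstep h2
      _ = q * (1 + (η + envMoment (shift ξ) n)) * (1 + m * s * η) := by rw [hA]; ring

end

/-! ### The tail of the maximal displacement -/

lemma le_maxDisplacement_iff (ω : Marks) (x : ℝ) :
    (x : EReal) ≤ maxDisplacement ω ↔ ∃ n, ω ∈ reach n ⌈x⌉ := by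
  constructor
  · intro h
    by_contra hcon
    have hlt (ν : List ℕ) (hν : ν ∈ tree ω) : position ω ν ≤ ⌈x⌉ - 1 := by
      by_contra h2
      exact hcon ⟨ν.length, ν, hν, le_rfl, by omega⟩
    have h3 : maxDisplacement ω ≤ (((⌈x⌉ - 1 : ℤ) : ℝ) : EReal) :=
      iSup_le fun n => iSup₂_le fun ν hν => EReal.coe_le_coe (by exact_mod_cast hlt ν hν.1)
    have h4 := EReal.coe_le_coe_iff.1 (h.trans h3)
    push_cast at h4
    linarith [Int.ceil_lt_add_one x]
  · rintro ⟨n, ν, hν, -, hp⟩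
    refine le_trans ?_ (le_iSup_of_le ν.length (le_iSup₂_of_le
      (f := fun (ν' : List ℕ) (_ : ν' ∈ {ν' ∈ tree ω | ν'.length = ν.length}) =>
        (((position ω ν' : ℤ) : ℝ) : EReal)) ν ⟨hν, rfl⟩ le_rfl))
    exact EReal.coe_le_coe ((Int.le_ceil x).trans (by exact_mod_cast hp))

section

variable (μ : Measure ℤ) [IsProbabilityMeasure μ]

lemma reachProb_le_quenchedTail (ξ : Environment) (n : ℕ) (x : ℝ) :
    reachProb μ ξ n ⌈x⌉ ≤ quenchedTail μ ξ x :=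
  measureReal_mono fun ω hω => (le_maxDisplacement_iff ω x).2 ⟨n, hω⟩

lemma quenchedTail_le (ξ : Environment) {x C : ℝ} (hC : ∀ n, reachProb μ ξ n ⌈x⌉ ≤ C) :
    quenchedTail μ ξ x ≤ C := by
  have h1 : {ω | (x : EReal) ≤ maxDisplacement ω} = ⋃ n, reach n ⌈x⌉ := by
    ext ω
    simp [le_maxDisplacement_iff]
  have h2 := (ENNReal.tendsto_toReal (measure_ne_top (quenchedLaw μ ξ) _)).comp
    (tendsto_measure_iUnion_atTop (μ := quenchedLaw μ ξ) (reach_mono ⌈x⌉))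
  rw [quenchedTail, h1]
  exact le_of_tendsto' h2 hC

end

/-! ### Almost sure properties of the environment -/

lemma measurable_offspringMean : Measurable offspringMean :=
  Measurable.tsum fun k => ((Measure.measurable_coe
    (measurableSet_singleton k)).comp measurable_subtype_coe).const_mul _

lemma measurable_logMean : Measurable logMean :=
  Real.measurable_log.comp measurable_offspringMean.ennreal_toReal

lemma measurable_normalizedFactorialMoment : Measurable normalizedFactorialMoment :=
  (Measurable.tsum fun k => ((Measure.measurable_coe
    (measurableSet_singleton k)).comp measurable_subtype_coe).const_mul _).div
      (measurable_offspringMean.pow_const 2)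

section

variable {Q : Measure (ProbabilityMeasure ℕ)} [IsProbabilityMeasure Q]

/-- The strong law of large numbers along the environment. -/
lemma ae_tendsto_average {f : ProbabilityMeasure ℕ → ℝ} (hf : Measurable f)
    (hi : Integrable f Q) :
    ∀ᵐ ξ ∂environmentLaw Q, Tendsto
      (fun n : ℕ => (∑ i ∈ Finset.range n, f (ξ (i + 1))) / n) atTop (𝓝 (∫ F, f F ∂Q)) := by
  have hmp (k : ℤ) : MeasurePreserving (Function.eval k) (environmentLaw Q) Q :=
    measurePreserving_eval_infinitePi (fun _ : ℤ => Q) k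
  have hind : iIndepFun (fun (k : ℤ) (ξ : Environment) => f (ξ k)) (environmentLaw Q) :=
    iIndepFun_infinitePi (X := fun _ => f) fun _ => hf
  have hmeas (k : ℤ) : Measurable fun ξ : Environment => f (ξ k) :=
    hf.comp (measurable_pi_apply k)
  have hmap (k : ℤ) : (environmentLaw Q).map (fun ξ => f (ξ k)) = Q.map f := by
    have h1 := Measure.map_map (μ := environmentLaw Q) hf (hmp k).measurable
    rw [(hmp k).map_eq] at h1
    exact h1.symm
  have h := strong_law_ae_real (μ := environmentLaw Q)
    (fun (i : ℕ) (ξ : Environment) => f (ξ (i + 1)))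
    ((hmp (((0 : ℕ) : ℤ) + 1)).integrable_comp_of_integrable hi)
    (fun i j hij => hind.indepFun (by simpa using hij))
    (fun i => ⟨(hmeas _).aemeasurable, (hmeas _).aemeasurable, by rw [hmap, hmap]⟩)
  have e : ∫ ξ, f (ξ (((0 : ℕ) : ℤ) + 1)) ∂environmentLaw Q = ∫ F, f F ∂Q := by
    have h1 := integral_map (μ := environmentLaw Q) (hmeas (((0 : ℕ) : ℤ) + 1)).aemeasurable
      (f := id) measurable_id.aestronglyMeasurable
    rw [hmap, integral_map hf.aemeasurable measurable_id.aestronglyMeasurable] at h1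
    exact h1.symm
  rw [e] at h
  exact h

lemma ae_nondegenerateEnvironment (hQ : SubcriticalEnvironment Q)
    (hη : ∫⁻ F, normalizedFactorialMoment F ∂Q < ∞) :
    ∀ᵐ ξ ∂environmentLaw Q, NondegenerateEnvironment ξ := by
  have h3 := ae_lt_top measurable_normalizedFactorialMoment hη.ne
  have hall : ∀ᵐ ξ ∂environmentLaw Q, ∀ k : ℤ, offspringMean (ξ k) ≠ 0 ∧
      offspringMean (ξ k) ≠ ∞ ∧ normalizedFactorialMoment (ξ k) < ∞ := by
    refine ae_all_iff.2 fun k => ?_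
    exact (measurePreserving_eval_infinitePi (fun _ : ℤ => Q) k).quasiMeasurePreserving.ae
      (hQ.mean_ne_zero.and (hQ.mean_ne_top.and h3))
  filter_upwards [hall] with ξ h
  exact ⟨fun k => (h k).1, fun k => (h k).2.1, fun k => (h k).2.2.ne⟩

end

/-! ### Exponential decay of the tail -/

lemma exists_abs_sub_le {u : ℕ → ℝ} {a : ℝ} (hu : Tendsto (fun n : ℕ => u n / n) atTop (𝓝 a))
    {ε : ℝ} (hε : 0 < ε) : ∃ C, ∀ n : ℕ, |u n - a * n| ≤ ε * n + C := by
  obtain ⟨N, hN⟩ := Metric.tendsto_atTop.1 hu ε hε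
  refine ⟨∑ i ∈ Finset.range (N + 1), |u i - a * i|, fun n => ?_⟩
  have hC : 0 ≤ ∑ i ∈ Finset.range (N + 1), |u i - a * i| :=
    Finset.sum_nonneg fun _ _ => abs_nonneg _
  rcases le_or_gt n N with h | h
  · have := Finset.single_le_sum (f := fun i : ℕ => |u i - a * i|) (fun _ _ => abs_nonneg _)
      (Finset.mem_range.2 (Nat.lt_succ_of_le h))
    have h0 : 0 ≤ ε * n := by positivity
    linarith
  · have hn : (0 : ℝ) < n := by exact_mod_cast (Nat.zero_le N).trans_lt h
    have h1 := (hN n h.le).le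
    rw [Real.dist_eq] at h1
    have h2 : u n - a * n = (u n / n - a) * n := by field_simp
    rw [h2, abs_mul, abs_of_pos hn]
    nlinarith

section

variable {μ : Measure ℤ} [IsProbabilityMeasure μ] {ξ : Environment} {a : ℝ}

lemma quenchedTail_le_exp (hμ : JumpAssumption μ) (hξ : NondegenerateEnvironment ξ)
    (hS : Tendsto (fun n : ℕ => envWalk ξ n / n) atTop (𝓝 a)) {l : ℝ} (hl : 0 ≤ l)
    (hla : jumpLaplace μ l < Real.exp (-a)) :
    ∃ C, ∀ x : ℝ, quenchedTail μ ξ x ≤ Real.exp (-l * x + C) := by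
  have hφ : 0 < jumpLaplace μ l := by linarith [one_le_jumpLaplace hμ hl]
  set b := Real.log (jumpLaplace μ l) with hb
  have hba : b < -a := (Real.log_lt_iff_lt_exp hφ).2 hla
  obtain ⟨C, hC⟩ := exists_abs_sub_le hS (ε := (-a - b) / 2) (by linarith)
  set r := Real.exp ((a + b) / 2) with hr
  have hr1 : r < 1 := Real.exp_lt_one_iff.2 (by linarith)
  have hW (n : ℕ) : laplaceMean μ l ξ n ≤ Real.exp C * r ^ n := by
    rw [laplaceMean, ← Real.exp_log hφ, ← hb, hr, ← Real.exp_nat_mul, ← Real.exp_nat_mul,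
      ← Real.exp_add, ← Real.exp_add]
    refine Real.exp_le_exp.2 ?_
    have := (abs_le.1 (hC n)).2
    linarith
  have hsum : ∀ n, ∑ j ∈ Finset.range n, laplaceMean μ l ξ j ≤ Real.exp C * (1 - r)⁻¹ := by
    intro n
    refine (Finset.sum_le_sum fun j _ => hW j).trans ?_
    rw [← Finset.mul_sum, ← tsum_geometric_of_lt_one (Real.exp_pos _).le hr1]
    exact mul_le_mul_of_nonneg_left ((summable_geometric_of_lt_one (Real.exp_pos _).le
      hr1).sum_le_tsum _ fun i _ => pow_nonneg (Real.exp_pos _).le i) (Real.exp_pos _).le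
  have h1r : 0 < (1 - r)⁻¹ := inv_pos.2 (by linarith)
  refine ⟨C + Real.log (1 - r)⁻¹, fun x => quenchedTail_le μ ξ fun n => ?_⟩
  rw [Real.exp_add, Real.exp_add, Real.exp_log h1r]
  refine (reachProb_le hμ hl hξ n ⌈x⌉).trans
    (mul_le_mul (Real.exp_le_exp.2 ?_) (hsum _) ?_ (Real.exp_pos _).le)
  · have := mul_le_mul_of_nonneg_left (Int.le_ceil x) hl
    linarith
  · exact Finset.sum_nonneg fun j _ => (laplaceMean_pos hμ hl ξ j).le

lemma exp_le_quenchedTail (hμ : JumpAssumption μ) (hξ : NondegenerateEnvironment ξ)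
    (hS : Tendsto (fun n : ℕ => envWalk ξ n / n) atTop (𝓝 a)) {b : ℝ}
    (hM : Tendsto (fun n : ℕ => envMoment ξ n / n) atTop (𝓝 b)) {l : ℝ} (hl : 0 < l)
    (hla : jumpLaplace μ l = Real.exp (-a)) (ha : a < 0) {ε : ℝ} (hε : 0 < ε) :
    ∃ C, ∀ x : ℝ, 0 < x → Real.exp (-(l + ε) * x - C) ≤ quenchedTail μ ξ x := by
  have hφ1 : 1 < jumpLaplace μ l := by rw [hla]; exact Real.one_lt_exp_iff.2 (by linarith)
  have hv := tiltedDrift_pos hμ hl hφ1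
  set v := tiltedDrift μ l with hvdef
  -- the horizon is about `2 x / v`, and each of two error terms costs `ε₁` per generation
  set ε₁ := v * ε / 4 with hε₁
  have hε₁0 : 0 < ε₁ := by positivity
  obtain ⟨C₁, hC₁⟩ := exists_abs_sub_le hS hε₁0
  obtain ⟨C₂, hC₂⟩ := exists_abs_sub_le hM one_pos
  set K := 1 + |b| + |C₂| with hK
  have hK0 : 0 < K := by positivity
  have hmom (n : ℕ) : 1 + envMoment ξ n ≤ Real.exp (ε₁ * (n + 1) + Real.log ((1 + K) / ε₁)) := by
    rw [Real.exp_add, Real.exp_log (by positivity)]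
    have h1 := (abs_le.1 (hC₂ n)).2
    have h2 : b * n ≤ |b| * n := mul_le_mul_of_nonneg_right (le_abs_self b) (Nat.cast_nonneg n)
    have h3 : ε₁ * (n + 1) ≤ Real.exp (ε₁ * (n + 1)) := by
      linarith [Real.add_one_le_exp (ε₁ * ((n : ℝ) + 1))]
    have h4 : 0 ≤ |C₂| * n := by positivity
    have h5 := le_abs_self C₂
    have h6 := abs_nonneg b
    calc 1 + envMoment ξ n ≤ (1 + K) * (n + 1) := by
          rw [hK]; nlinarith [(Nat.cast_nonneg n : (0 : ℝ) ≤ n)]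
      _ = ε₁ * (n + 1) * ((1 + K) / ε₁) := by field_simp
      _ ≤ _ := mul_le_mul_of_nonneg_right h3 (by positivity)
  have h1K : 0 < (1 + K) / ε₁ := by positivity
  set L := Real.log ((1 + K) / ε₁) with hL
  refine ⟨ε + l + 3 * ε₁ + C₁ - Real.log (v / 2) + L, fun x hx => ?_⟩
  refine le_trans ?_ (reachProb_le_quenchedTail μ ξ ⌈2 * (⌈x⌉ : ℝ) / v⌉₊ x)
  have hx0 : 0 < ⌈x⌉ := Int.ceil_pos.2 hx
  have hx0' : (0 : ℝ) < ⌈x⌉ := by exact_mod_cast hx0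
  have hx1 := Int.ceil_lt_add_one x
  have hN := Nat.le_ceil (2 * (⌈x⌉ : ℝ) / v)
  have hN' := Nat.ceil_lt_add_one (a := 2 * (⌈x⌉ : ℝ) / v) (by positivity)
  set N := ⌈2 * (⌈x⌉ : ℝ) / v⌉₊ with hNdef
  have hN0 : (0 : ℝ) < N := lt_of_lt_of_le (by positivity) hN
  have hvN : 2 * (⌈x⌉ : ℝ) ≤ v * N := by
    rw [div_le_iff₀ hv] at hN
    linarith
  have hεN : 2 * ε₁ * N ≤ ε * (x + 1) + 2 * ε₁ := by
    have h1 : v * N ≤ 2 * (x + 1) + v := by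
      have : (N - 1 : ℝ) ≤ 2 * (⌈x⌉ : ℝ) / v := by linarith
      rw [le_div_iff₀ hv] at this
      linarith
    have h2 := mul_le_mul_of_nonneg_left h1 hε.le
    rw [hε₁]
    linarith
  have hκ (j : ℕ) (hj : j ≤ N) : Real.exp (-(ε₁ * N + C₁)) ≤ laplaceMean μ l ξ j := by
    rw [laplaceMean, hla, ← Real.exp_nat_mul, ← Real.exp_add]
    refine Real.exp_le_exp.2 ?_
    have h1 := (abs_le.1 (hC₁ j)).1
    have h2 : ε₁ * j ≤ ε₁ * N := mul_le_mul_of_nonneg_left (by exact_mod_cast hj) hε₁0.le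
    linarith
  have key := le_reachProb hμ hl.le hξ (Real.exp_pos (-(ε₁ * N + C₁))).le
    (inv_nonneg.2 hN0.le) N (inv_mul_cancel₀ hN0.ne').le hκ hx0.le
  rw [← hvdef] at key
  have h3 : v / 2 ≤ (N : ℝ)⁻¹ * (v * N - ⌈x⌉) := by
    rw [inv_mul_eq_div, le_div_iff₀ hN0]
    linarith
  have h4 := (mul_le_mul_of_nonneg_left h3 (by positivity)).trans
    (key.trans (mul_le_mul_of_nonneg_left (hmom N) (reachProb_nonneg μ ξ N ⌈x⌉)))
  rw [← Real.exp_log (show 0 < v / 2 by positivity), ← Real.exp_add, ← Real.exp_add] at h4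
  refine le_of_mul_le_mul_right (le_trans ?_ h4)
    (Real.exp_pos (ε₁ * (N + 1) + Real.log ((1 + K) / ε₁)))
  rw [← Real.exp_add]
  refine Real.exp_le_exp.2 ?_
  have h5 := mul_le_mul_of_nonneg_left hx1.le hl.le
  linarith

lemma tendsto_log_quenchedTail (hμ : JumpAssumption μ) (hξ : NondegenerateEnvironment ξ)
    (hS : Tendsto (fun n : ℕ => envWalk ξ n / n) atTop (𝓝 a)) {b : ℝ}
    (hM : Tendsto (fun n : ℕ => envMoment ξ n / n) atTop (𝓝 b)) {l : ℝ} (hl : 0 < l)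
    (hla : jumpLaplace μ l = Real.exp (-a)) (ha : a < 0) :
    Tendsto (fun x : ℝ => 1 / x * Real.log (quenchedTail μ ξ x)) atTop (𝓝 (-l)) := by
  refine tendsto_order.2 ⟨fun y hy => ?_, fun y hy => ?_⟩
  · set ε := (-l - y) / 2 with hεdef
    have hε : 0 < ε := by rw [hεdef]; linarith
    obtain ⟨C, hC⟩ := exp_le_quenchedTail hμ hξ hS hM hl hla ha hε
    filter_upwards [eventually_gt_atTop 0, eventually_gt_atTop (C / ε)] with x hx hxC
    have h1 := Real.log_le_log (Real.exp_pos _) (hC x hx)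
    rw [Real.log_exp] at h1
    rw [one_div_mul_eq_div, lt_div_iff₀ hx]
    rw [div_lt_iff₀ hε] at hxC
    have h2 : y = -l - 2 * ε := by rw [hεdef]; ring
    rw [h2]
    linarith
  · obtain ⟨l', hl', hll⟩ := exists_between (max_lt hl (neg_lt.1 hy))
    obtain ⟨hl'0, hl'y⟩ := max_lt_iff.1 hl'
    have hlt : jumpLaplace μ l' < Real.exp (-a) := hla ▸ jumpLaplace_lt_of_lt hμ hl'0 hll
      (by rw [hla]; exact Real.one_lt_exp_iff.2 (by linarith))
    obtain ⟨C, hC⟩ := quenchedTail_le_exp hμ hξ hS hl'0.le hlt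
    obtain ⟨C', hC'⟩ := exp_le_quenchedTail hμ hξ hS hM hl hla ha one_pos
    have hd : 0 < y + l' := by linarith
    filter_upwards [eventually_gt_atTop 0, eventually_gt_atTop (C / (y + l'))] with x hx hxC
    have h1 := Real.log_le_log ((Real.exp_pos _).trans_le (hC' x hx)) (hC x)
    rw [Real.log_exp] at h1
    rw [one_div_mul_eq_div, div_lt_iff₀ hx]
    rw [div_lt_iff₀ hd] at hxC
    linarith

end

end BRWRE

end

theorem theorem1 (Q : Measure (ProbabilityMeasure ℕ)) [IsProbabilityMeasure Q]
    (μ : Measure ℤ) [IsProbabilityMeasure μ]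
    (hQ : BRWRE.SubcriticalEnvironment Q) (hμ : BRWRE.JumpAssumption μ)
    (hη : ∫⁻ F, BRWRE.normalizedFactorialMoment F ∂Q < ∞) :
    ∃ lam0 : ℝ,
      (0 < lam0 ∧ BRWRE.jumpLogLaplace μ lam0 = -∫ F, BRWRE.logMean F ∂Q) ∧
      (∀ l : ℝ, 0 < l → BRWRE.jumpLogLaplace μ l = -∫ F, BRWRE.logMean F ∂Q → l = lam0) ∧
      ∀ᵐ ξ ∂BRWRE.environmentLaw Q,
        Tendsto (fun x : ℝ => 1 / x * Real.log (BRWRE.quenchedTail μ ξ x)) atTop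
          (𝓝 (-lam0)) := by
  have ha := hQ.integral_logMean_neg
  have hc : 1 < Real.exp (-∫ F, BRWRE.logMean F ∂Q) := Real.one_lt_exp_iff.2 (by linarith)
  obtain ⟨l₀, hl₀, hla⟩ := BRWRE.exists_jumpLaplace_eq hμ hc
  refine ⟨l₀, ⟨hl₀, by rw [BRWRE.jumpLogLaplace_eq, hla, Real.log_exp]⟩, fun l hl hll => ?_, ?_⟩
  · have hla' : BRWRE.jumpLaplace μ l = Real.exp (-∫ F, BRWRE.logMean F ∂Q) := by
      rw [← hll, BRWRE.jumpLogLaplace_eq, Real.exp_log]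
      linarith [BRWRE.one_le_jumpLaplace hμ hl.le]
    rcases lt_trichotomy l l₀ with h | h | h
    · have := BRWRE.jumpLaplace_lt_of_lt hμ hl h (hla ▸ hc)
      linarith
    · exact h
    · have := BRWRE.jumpLaplace_lt_of_lt hμ hl₀ h (hla' ▸ hc)
      linarith
  · filter_upwards [BRWRE.ae_nondegenerateEnvironment hQ hη,
      BRWRE.ae_tendsto_average BRWRE.measurable_logMean hQ.integrable_logMean,
      BRWRE.ae_tendsto_average BRWRE.measurable_normalizedFactorialMoment.ennreal_toReal
        (integrable_toReal_of_lintegral_ne_top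
          BRWRE.measurable_normalizedFactorialMoment.aemeasurable hη.ne)] with ξ hξ hS hM
    exact BRWRE.tendsto_log_quenchedTail hμ hξ hS hM hl₀ hla ha
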